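/- Let $p$ be a prime and let $(R,\mathfrak m)$ be a pro-$p$ domain, i.e. a Noetherian local integral domain, complete with respect to its maximal ideal $\mathfrak m$, whose residue field is finite of characteristic $p$; give $R$ the $\mathfrak m$-adic topology. A map $f$ from an open subset $U$ of $R^{(n)}$ to $R^{(m)}$ is $R$-analytic if for every $y\in U$ there are an integer $N\ge 1$ with $y+(\mathfrak m^N)^{(n)}\subseteq U$ and power series $F_1,\dots,F_m\in R[[X_1,\dots,X_n]]$ with $f(y+x)=(F_1(x),\dots,F_m(x))$ for all $x\in(\mathfrak m^N)^{(n)}$. An $R$-analytic group of dimension $d$ is a topological group $G$ with an atlas of charts onto open subsets of $R^{(d)}$ whose transition maps are $R$-analytic, such that multiplication $G\times G\to G$ and inversion $G\to G$ are $R$-analytic in these charts. Let $G$ be a compact $R$-analytic group of dimension $d$. Then there are an open normal subgroup $S$ of $G$, an integer $N\ge 1$ and a homeomorphism $\phi\colon S\to(\mathfrak m^N)^{(d)}$ which is a chart compatible with the $R$-analytic structure of $G$, such that: (a) $(S,\phi)$ is an $R$-standard group of level $N$ and dimension $d$, that is, $\phi(1)=\mathbf 0$ and there are power series $F_1,\dots,F_d\in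 R[[X_1,\dots,X_{2d}]]$ with constant term zero such that $\phi(xy)=\bigl(F_1(\phi(x),\phi(y)),\dots,F_d(\phi(x),\phi(y))\bigr)$ for all $x,y\in S$; (b) for every $g\in G$ there is a tuple of power series $\mathbf C_g=(C_1^g,\dots,C_d^g)\in R[[X_1,\dots,X_d]]^{(d)}$ such that $\phi(g^{-1}xg)=\mathbf C_g(\phi(x))$ for all $x\in S$. -/

import Mathlib

open IsLocalRing

namespace RAnalytic

universe u v

/-- The formal power series `F ∈ R[[X_i : i ∈ ι]]` converges at the point `x`, with value `y`:
`∑_e (coeff e F) * x ^ e = y` in the topology of `R`. -/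
def HasValueAt {R : Type u} [CommRing R] [TopologicalSpace R] {ι : Type*}
    (F : MvPowerSeries ι R) (x : ι → R) (y : R) : Prop :=
  HasSum (fun e : ι →₀ ℕ => MvPowerSeries.coeff e F * e.prod fun i k => x i ^ k) y

/-- The Cartesian power `(𝔪 ^ N)^(ι)` inside `R^(ι)`, where `𝔪` is the maximal ideal of the local
ring `R`. -/
def polydisc (R : Type u) [CommRing R] [IsLocalRing R] (ι : Type*) (N : ℕ) : Set (ι → R) :=
  {x | ∀ i, x i ∈ maximalIdeal R ^ N}

/-- `f` is `R`-analytic at `y`: on some neighbourhood `y + (𝔪 ^ N)^(ι)` of `y` it is given by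
power series with coefficients in `R`, that is, `f (y + x) = F(x)` for all `x ∈ (𝔪 ^ N)^(ι)`. -/
def IsAnalyticAt {R : Type u} [CommRing R] [IsLocalRing R] [TopologicalSpace R] {ι κ : Type*}
    (f : (ι → R) → (κ → R)) (y : ι → R) : Prop :=
  ∃ (N : ℕ) (F : κ → MvPowerSeries ι R),
    ∀ x ∈ polydisc R ι N, ∀ j, HasValueAt (F j) x (f (y + x) j)

/-- `f` is `R`-analytic at every point of the (in practice open) set `U`. -/
def IsAnalyticOn {R : Type u} [CommRing R] [IsLocalRing R] [TopologicalSpace R] {ι κ : Type*}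
    (f : (ι → R) → (κ → R)) (U : Set (ι → R)) : Prop :=
  ∀ y ∈ U, IsAnalyticAt f y

/-- Two `d`-dimensional charts of `M` are compatible: both transition maps are `R`-analytic on the
images of the intersection of the two domains. -/
def Compatible {R : Type u} [CommRing R] [IsLocalRing R] [TopologicalSpace R] {d : ℕ}
    {M : Type v} [TopologicalSpace M] (e e' : OpenPartialHomeomorph M (Fin d → R)) : Prop :=
  IsAnalyticOn (fun x => e' (e.symm x)) (e.symm.trans e').source ∧
  IsAnalyticOn (fun x => e (e'.symm x)) (e'.symm.trans e).source

/-- `R`-analytic groups of dimension `d`: topological groups with an atlas of pairwise compatible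
charts onto open subsets of `R^(d)`, such that multiplication and inversion are `R`-analytic
in the charts of the atlas. -/
class IsAnalyticGroup (R : Type u) [CommRing R] [IsLocalRing R] [TopologicalSpace R] (d : ℕ)
    (G : Type v) [Group G] [TopologicalSpace G] [ChartedSpace (Fin d → R) G] : Prop
    extends IsTopologicalGroup G where
  compatible : ∀ e ∈ atlas (Fin d → R) G, ∀ e' ∈ atlas (Fin d → R) G, Compatible e e'
  analytic_mul : ∀ e₁ ∈ atlas (Fin d → R) G, ∀ e₂ ∈ atlas (Fin d → R) G,
    ∀ e₃ ∈ atlas (Fin d → R) G,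
      IsAnalyticOn
        (fun z : Fin d ⊕ Fin d → R => e₃ (e₁.symm (z ∘ Sum.inl) * e₂.symm (z ∘ Sum.inr)))
        {z | z ∘ Sum.inl ∈ e₁.target ∧ z ∘ Sum.inr ∈ e₂.target ∧
          e₁.symm (z ∘ Sum.inl) * e₂.symm (z ∘ Sum.inr) ∈ e₃.source}
  analytic_inv : ∀ e₁ ∈ atlas (Fin d → R) G, ∀ e₂ ∈ atlas (Fin d → R) G,
      IsAnalyticOn (fun x => e₂ (e₁.symm x)⁻¹)
        {x | x ∈ e₁.target ∧ (e₁.symm x)⁻¹ ∈ e₂.source}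

/-- Let `G` be an `R`-analytic group of dimension `d`, and let the open subgroup `S` carry the
`R`-analytic structure induced from `G`. Then `(S, φ)` is an `R`-standard group of level `N` (and
dimension `d`). The chart `φ`, whose domain is the whole of `S`, is a global atlas of `S` because
it is compatible with the charts of `G`. -/
structure IsStandardSubgroup {R : Type u} [CommRing R] [IsLocalRing R] [TopologicalSpace R] {d : ℕ}
    {G : Type v} [Group G] [TopologicalSpace G] [ChartedSpace (Fin d → R) G]
    (S : Subgroup G) (N : ℕ) (φ : OpenPartialHomeomorph G (Fin d → R)) : Prop where
  level_pos : 0 < N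
  source_eq : φ.source = (S : Set G)
  target_eq : φ.target = polydisc R (Fin d) N
  compatible : ∀ e ∈ atlas (Fin d → R) G, Compatible φ e
  map_one : φ 1 = 0
  map_mul : ∃ F : Fin d → MvPowerSeries (Fin d ⊕ Fin d) R,
    (∀ j, MvPowerSeries.constantCoeff (F j) = 0) ∧
    ∀ x ∈ S, ∀ y ∈ S, ∀ j, HasValueAt (F j) (Sum.elim (φ x) (φ y)) (φ (x * y) j)

end RAnalytic

/-! A power series with zero constant term that converges on the polydisc of level `N` maps the
polydisc of every level at least `N` into itself (`HasValueAt.sub_constantCoeff_mem`). Take the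
chart at `1`, translated so that `1` has coordinate `0`. Near `0` the group operations are power
series fixing `0`, so at every sufficiently deep level the polydisc is the image of an open
subgroup.

Conjugation by a fixed `g` also fixes `1` and is analytic there, so it preserves all polydiscs
deeper than some level depending on `g`. Compactness makes this level uniform
(`exists_forall_conjExpansion`): the subgroup of a fixed level `M` has finite index, its own
elements act by power series at every level beyond `M`, and the maximum over finitely many coset
representatives handles the rest. At the resulting level the subgroup is normal. Composites remain
power series because substitution commutes with evaluation (`exists_hasValueAt_subst`). -/

open IsLocalRing Filter Topology

namespace RAnalytic

/-! ### Pointwise evaluation of formal power series -/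

section PowerSeries

variable {R : Type*} [CommRing R] [IsLocalRing R] {ι κ κ' : Type*}

lemma polydisc_mono {M N : ℕ} (h : M ≤ N) : polydisc R ι N ⊆ polydisc R ι M :=
  fun _ hx i => Ideal.pow_le_pow_right h (hx i)

lemma zero_mem_polydisc (N : ℕ) : (0 : ι → R) ∈ polydisc R ι N :=
  fun _ => Ideal.zero_mem _

lemma elim_mem_polydisc {N : ℕ} {x : ι → R} {y : κ → R} (hx : x ∈ polydisc R ι N)
    (hy : y ∈ polydisc R κ N) : Sum.elim x y ∈ polydisc R (ι ⊕ κ) N := by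
  rintro (i | i)
  exacts [hx i, hy i]

variable [TopologicalSpace R]

/-- `f` is given by a tuple of power series on the whole of `(𝔪 ^ N)^(ι)`. -/
def HasExpansionOn (f : (ι → R) → (κ → R)) (N : ℕ) : Prop :=
  ∃ F : κ → MvPowerSeries ι R, ∀ x ∈ polydisc R ι N, ∀ j, HasValueAt (F j) x (f x j)

lemma HasExpansionOn.mono {f : (ι → R) → (κ → R)} {M N : ℕ} (hf : HasExpansionOn f M)
    (h : M ≤ N) : HasExpansionOn f N :=
  hf.imp fun _ hF x hx => hF x (polydisc_mono h hx)

lemma HasExpansionOn.congr {f g : (ι → R) → (κ → R)} {N : ℕ} (hf : HasExpansionOn f N)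
    (h : Set.EqOn f g (polydisc R ι N)) : HasExpansionOn g N :=
  hf.imp fun _ hF x hx => h hx ▸ hF x hx

lemma HasExpansionOn.sumElim {f : (ι → R) → (κ → R)} {g : (ι → R) → (κ' → R)} {N : ℕ}
    (hf : HasExpansionOn f N) (hg : HasExpansionOn g N) :
    HasExpansionOn (fun x => Sum.elim (f x) (g x)) N := by
  obtain ⟨F, hF⟩ := hf
  obtain ⟨G, hG⟩ := hg
  refine ⟨Sum.elim F G, fun x hx => ?_⟩
  rintro (j | j)
  exacts [hF x hx j, hG x hx j]

omit [IsLocalRing R] in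
lemma hasValueAt_of_forall_ne {F : MvPowerSeries ι R} {x : ι → R} {y : R} (e₀ : ι →₀ ℕ)
    (h : ∀ e ≠ e₀, MvPowerSeries.coeff e F * e.prod (fun i k => x i ^ k) = 0)
    (h₀ : MvPowerSeries.coeff e₀ F * e₀.prod (fun i k => x i ^ k) = y) : HasValueAt F x y :=
  h₀ ▸ hasSum_single e₀ h

omit [IsLocalRing R] in
lemma hasValueAt_C (c : R) (x : ι → R) : HasValueAt (MvPowerSeries.C c) x c := by
  classical
  refine hasValueAt_of_forall_ne 0 (fun e he => ?_) (by simp)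
  simp [MvPowerSeries.coeff_C, he]

omit [IsLocalRing R] in
lemma hasValueAt_X (i : ι) (x : ι → R) : HasValueAt (MvPowerSeries.X i) x (x i) := by
  classical
  refine hasValueAt_of_forall_ne (Finsupp.single i 1) (fun e he => ?_) (by simp)
  simp [MvPowerSeries.coeff_X, he]

lemma hasExpansionOn_const (c : κ → R) (N : ℕ) : HasExpansionOn (fun _ : ι → R => c) N :=
  ⟨fun j => MvPowerSeries.C (c j), fun x _ j => hasValueAt_C (c j) x⟩

lemma hasExpansionOn_id (N : ℕ) : HasExpansionOn (fun x : ι → R => x) N :=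
  ⟨fun j => MvPowerSeries.X j, fun x _ j => hasValueAt_X j x⟩

omit [IsLocalRing R] in
lemma hasValueAt_zero (F : MvPowerSeries ι R) :
    HasValueAt F 0 (MvPowerSeries.constantCoeff F) := by
  refine hasValueAt_of_forall_ne 0 (fun e he => ?_) (by simp)
  obtain ⟨i, hi⟩ := Finsupp.ne_iff.mp he
  rw [Finsupp.prod, Finset.prod_eq_zero (i := i) (by simpa using hi)
    (by simpa using zero_pow hi), mul_zero]

lemma HasExpansionOn.sub_const [ContinuousAdd R] {f : (ι → R) → (κ → R)} {N : ℕ}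
    (hf : HasExpansionOn f N) (c : κ → R) : HasExpansionOn (fun x => f x - c) N := by
  obtain ⟨F, hF⟩ := hf
  refine ⟨fun j => F j + MvPowerSeries.C (-c j), fun x hx j => ?_⟩
  have := (hF x hx j).add (hasValueAt_C (-c j) x)
  simpa [HasValueAt, add_mul, sub_eq_add_neg] using this

end PowerSeries

/-! ### Convergence, composition and analyticity in the adic topology -/

section Adic

variable {R : Type*} [CommRing R] [IsLocalRing R] [TopologicalSpace R] {ι κ κ' : Type*}

omit [IsLocalRing R] in
lemma isTopologicalRing_of_isAdic {I : Ideal R} (hI : IsAdic I) : IsTopologicalRing R := by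
  let := WithIdeal.mk I
  subst hI
  exact inferInstanceAs (@IsTopologicalRing R (WithIdeal.instTopologicalSpace R) _)

omit [IsLocalRing R] in
lemma isLinearTopology_of_isAdic {I : Ideal R} (hI : IsAdic I) : IsLinearTopology R R := by
  subst hI
  exact I.isLinearTopology

lemma hasEval_of_mem_polydisc [Finite ι] (hR : IsAdic (maximalIdeal R)) {x : ι → R}
    (hx : x ∈ polydisc R ι 1) : MvPowerSeries.HasEval x where
  hpow i := by
    have hxi : x i ∈ maximalIdeal R := by simpa only [pow_one] using hx i
    subst hR
    let := WithIdeal.mk (maximalIdeal R)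
    exact WithIdeal.isTopologicallyNilpotent_of_mem hxi
  tendsto_zero := by simp [cofinite_eq_bot]

open MvPowerSeries.WithPiTopology in
/-- Substitution of power series into power series is compatible with evaluation. -/
theorem exists_hasValueAt_subst [Finite ι] [Finite κ] [IsAdicComplete (maximalIdeal R) R]
    (hR : IsAdic (maximalIdeal R)) (F : MvPowerSeries κ R) (G : κ → MvPowerSeries ι R)
    (hG : ∀ j, MvPowerSeries.constantCoeff (G j) ∈ maximalIdeal R) :
    ∃ H : MvPowerSeries ι R, ∀ x ∈ polydisc R ι 1, ∀ z : κ → R,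
      (∀ j, HasValueAt (G j) x (z j)) → ∀ y, HasValueAt F z y → HasValueAt H x y := by
  have := isTopologicalRing_of_isAdic hR
  have := isLinearTopology_of_isAdic hR
  let : UniformSpace R := IsTopologicalAddGroup.rightUniformSpace R
  have : IsUniformAddGroup R := isUniformAddGroup_of_addCommGroup
  -- Adic completeness gives completeness and separation for the additive uniformity.
  obtain ⟨_, _⟩ := (IsAdic.isAdicComplete_iff hR).mp inferInstance
  have hGe : MvPowerSeries.HasEval G :=
    { hpow := fun j => MvPowerSeries.LinearTopology.isTopologicallyNilpotent_of_constantCoeff <|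
        (hasEval_of_mem_polydisc (ι := κ) hR
          (x := fun j => MvPowerSeries.constantCoeff (G j)) (by simpa [polydisc] using hG)).hpow j
      tendsto_zero := by simp [cofinite_eq_bot] }
  -- The substitution is the evaluation of `F` at `G` in the power series ring itself. Evaluation at
  -- `x` is a continuous algebra map, hence passes through it, and uniqueness of sums identifies the
  -- values.
  refine ⟨MvPowerSeries.aeval hGe F, fun x hx z hz y hy => ?_⟩
  have hxe := hasEval_of_mem_polydisc hR hx
  have hzG : z = fun j => MvPowerSeries.aeval hxe (G j) := funext fun j =>
    (hz j).unique (MvPowerSeries.hasSum_aeval hxe (G j))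
  subst hzG
  have hcomp := MvPowerSeries.comp_aeval hGe (MvPowerSeries.continuous_aeval hxe)
  have h1 := MvPowerSeries.hasSum_aeval hxe (MvPowerSeries.aeval hGe F)
  have h2 := MvPowerSeries.hasSum_aeval (hGe.map (MvPowerSeries.continuous_aeval hxe)) F
  rw [← hcomp] at h2
  have h3 : y = MvPowerSeries.aeval hxe (MvPowerSeries.aeval hGe F) := hy.unique h2
  rw [h3]
  exact h1

lemma isClosed_pow_maximalIdeal (hR : IsAdic (maximalIdeal R)) (N : ℕ) :
    IsClosed ((maximalIdeal R ^ N : Ideal R) : Set R) := by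
  have := isTopologicalRing_of_isAdic hR
  exact AddSubgroup.isClosed_of_isOpen (maximalIdeal R ^ N).toAddSubgroup
    ((isAdic_iff.mp hR).1 N)

lemma isOpen_polydisc [Finite ι] (hR : IsAdic (maximalIdeal R)) (N : ℕ) :
    IsOpen (polydisc R ι N) := by
  have := isTopologicalRing_of_isAdic hR
  have : polydisc R ι N = Set.univ.pi fun _ => ((maximalIdeal R ^ N : Ideal R) : Set R) := by
    ext x; simp [polydisc]
  rw [this]
  exact isOpen_set_pi Set.finite_univ fun _ _ => (isAdic_iff.mp hR).1 N

lemma exists_polydisc_subset [Finite ι] (hR : IsAdic (maximalIdeal R)) {U : Set (ι → R)}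
    (hU : U ∈ 𝓝 0) : ∃ N, polydisc R ι N ⊆ U := by
  rw [nhds_pi, Filter.mem_pi'] at hU
  obtain ⟨I, t, ht, htU⟩ := hU
  choose n hn using fun i => hR.hasBasis_nhds_zero.mem_iff.mp (ht i)
  refine ⟨I.sup n, fun x hx => htU fun i hi => (hn i).2 ?_⟩
  exact Ideal.pow_le_pow_right (Finset.le_sup hi) (hx i)

/-- Every nonconstant monomial at `x` has a factor in `𝔪 ^ N`, and `𝔪 ^ N` is closed, so the sum of
these terms stays in it. -/
lemma HasValueAt.sub_constantCoeff_mem (hR : IsAdic (maximalIdeal R)) {F : MvPowerSeries ι R}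
    {x : ι → R} {y : R} {N : ℕ} (hx : x ∈ polydisc R ι N) (h : HasValueAt F x y) :
    y - MvPowerSeries.constantCoeff F ∈ maximalIdeal R ^ N := by
  classical
  have := isTopologicalRing_of_isAdic hR
  -- Adding the series `-F(0)` cancels the constant term.
  have h' := h.add (hasValueAt_C (-MvPowerSeries.constantCoeff F) x)
  rw [← sub_eq_add_neg] at h'
  refine (isClosed_pow_maximalIdeal hR N).mem_of_tendsto h' (Eventually.of_forall fun s => ?_)
  refine Ideal.sum_mem _ fun e _ => ?_
  rw [← add_mul]
  by_cases he : e = 0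
  · subst he
    simp
  · obtain ⟨i, hi⟩ := Finsupp.ne_iff.mp he
    refine Ideal.mul_mem_left _ _ ?_
    rw [Finsupp.prod, ← Finset.mul_prod_erase _ _ (Finsupp.mem_support_iff.mpr hi)]
    exact Ideal.mul_mem_right _ _ (Ideal.pow_mem_of_mem _ (hx i) _ (Nat.pos_of_ne_zero hi))

omit [IsLocalRing R] in
lemma constantCoeff_eq_of_hasValueAt [T2Space R] {F : MvPowerSeries ι R} {y : R}
    (h : HasValueAt F 0 y) : MvPowerSeries.constantCoeff F = y :=
  (hasValueAt_zero F).unique h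

variable [IsAdicComplete (maximalIdeal R) R]

/-- An expansion at one level controls all deeper levels `M`; this is what lets levels be increased
freely later on. -/
lemma HasExpansionOn.sub_mem_polydisc (hR : IsAdic (maximalIdeal R))
    {f : (ι → R) → (κ → R)} {M N : ℕ} (hf : HasExpansionOn f N) (hMN : N ≤ M)
    {x : ι → R} (hx : x ∈ polydisc R ι M) : f x - f 0 ∈ polydisc R κ M := by
  have := hR.isHausdorff_iff.mp inferInstance
  obtain ⟨F, hF⟩ := hf
  intro j
  have h := (hF x (polydisc_mono hMN hx) j).sub_constantCoeff_mem hR hx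
  rwa [constantCoeff_eq_of_hasValueAt (hF 0 (zero_mem_polydisc N) j)] at h

lemma HasExpansionOn.mem_polydisc (hR : IsAdic (maximalIdeal R))
    {f : (ι → R) → (κ → R)} {M N : ℕ} (hf : HasExpansionOn f N) (hMN : N ≤ M)
    (h0 : f 0 = 0) {x : ι → R} (hx : x ∈ polydisc R ι M) : f x ∈ polydisc R κ M := by
  simpa [h0] using hf.sub_mem_polydisc hR hMN hx

/-- Level at least `1` puts the constant terms `g 0` of the inner series in `𝔪`, as substitution
requires. -/
theorem HasExpansionOn.comp [Finite ι] [Finite κ] (hR : IsAdic (maximalIdeal R))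
    {f : (κ → R) → (κ' → R)} {g : (ι → R) → (κ → R)} {M N : ℕ} (hM : 1 ≤ M) (hN : 1 ≤ N)
    (hf : HasExpansionOn f M) (hg : HasExpansionOn g N)
    (hmaps : ∀ x ∈ polydisc R ι N, g x ∈ polydisc R κ M) :
    HasExpansionOn (fun x => f (g x)) N := by
  have := hR.isHausdorff_iff.mp inferInstance
  obtain ⟨F, hF⟩ := hf
  obtain ⟨G, hG⟩ := hg
  have hG0 : ∀ j, MvPowerSeries.constantCoeff (G j) ∈ maximalIdeal R := fun j => by
    rw [constantCoeff_eq_of_hasValueAt (hG 0 (zero_mem_polydisc N) j)]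
    simpa using polydisc_mono hM (hmaps 0 (zero_mem_polydisc N)) j
  choose H hH using fun j => exists_hasValueAt_subst hR (F j) G hG0
  exact ⟨H, fun x hx j => hH j x (polydisc_mono hN hx) (g x) (hG x hx) _ (hF _ (hmaps x hx) j)⟩

omit [IsAdicComplete (maximalIdeal R) R] in
lemma IsAnalyticAt.congr [Finite ι] (hR : IsAdic (maximalIdeal R)) {f g : (ι → R) → (κ → R)}
    {y : ι → R} (hf : IsAnalyticAt f y) (h : f =ᶠ[𝓝 y] g) : IsAnalyticAt g y := by
  have := isTopologicalRing_of_isAdic hR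
  have ht : Tendsto (fun x => y + x) (𝓝 0) (𝓝 y) := by
    simpa using (tendsto_const_nhds (x := y)).add (tendsto_id (x := 𝓝 (0 : ι → R)))
  have h' : ∀ᶠ x in 𝓝 (0 : ι → R), f (y + x) = g (y + x) := ht.eventually h
  obtain ⟨N, hN⟩ := exists_polydisc_subset hR h'
  obtain ⟨M, hM⟩ : ∃ M, HasExpansionOn (fun x => f (y + x)) M := hf
  exact ⟨max M N, (hM.mono (le_max_left M N)).congr
    fun x hx => hN (polydisc_mono (le_max_right M N) hx)⟩

lemma IsAnalyticAt.comp [Finite ι] [Finite κ] (hR : IsAdic (maximalIdeal R))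
    {f : (κ → R) → (κ' → R)} {g : (ι → R) → (κ → R)} {y : ι → R}
    (hf : IsAnalyticAt f (g y)) (hg : IsAnalyticAt g y) :
    IsAnalyticAt (fun x => f (g x)) y := by
  have := isTopologicalRing_of_isAdic hR
  obtain ⟨M, hM⟩ : ∃ M, HasExpansionOn (fun x => f (g y + x)) M := hf
  obtain ⟨N, hN⟩ : ∃ N, HasExpansionOn (fun x => g (y + x)) N := hg
  set K := max 1 (max M N)
  have h1 : 1 ≤ K := le_max_left _ _
  have hMK : M ≤ K := (le_max_left M N).trans (le_max_right _ _)
  have hNK : N ≤ K := (le_max_right M N).trans (le_max_right _ _)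
  -- Centred at its value, the inner map fixes `0` and so preserves the polydisc of level `K`.
  have hgK := (hN.mono hNK).sub_const (g y)
  refine ⟨K, ((hM.mono hMK).comp hR h1 h1 hgK fun x hx => ?_).congr fun x _ => by simp⟩
  exact hgK.mem_polydisc hR le_rfl (by simp) hx

omit [IsAdicComplete (maximalIdeal R) R] in
lemma IsAnalyticAt.sumElim {f : (ι → R) → (κ → R)} {g : (ι → R) → (κ' → R)} {y : ι → R}
    (hf : IsAnalyticAt f y) (hg : IsAnalyticAt g y) :
    IsAnalyticAt (fun x => Sum.elim (f x) (g x)) y := by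
  obtain ⟨M, hM⟩ : ∃ M, HasExpansionOn (fun x => f (y + x)) M := hf
  obtain ⟨N, hN⟩ : ∃ N, HasExpansionOn (fun x => g (y + x)) N := hg
  exact ⟨max M N, (hM.mono (le_max_left M N)).sumElim (hN.mono (le_max_right M N))⟩

omit [IsAdicComplete (maximalIdeal R) R] in
lemma isAnalyticAt_const (c : κ → R) (y : ι → R) : IsAnalyticAt (fun _ => c) y :=
  ⟨0, hasExpansionOn_const c 0⟩

omit [IsAdicComplete (maximalIdeal R) R] in
lemma isAnalyticAt_id [ContinuousAdd R] (y : ι → R) : IsAnalyticAt (fun x => x) y :=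
  ⟨0, ((hasExpansionOn_id 0).sub_const (-y)).congr fun x _ => by simp [add_comm]⟩

omit [IsAdicComplete (maximalIdeal R) R] in
lemma IsAnalyticAt.sub_const [ContinuousAdd R] {f : (ι → R) → (κ → R)} {y : ι → R}
    (hf : IsAnalyticAt f y) (c : κ → R) : IsAnalyticAt (fun x => f x - c) y := by
  obtain ⟨N, hN⟩ : ∃ N, HasExpansionOn (fun x => f (y + x)) N := hf
  exact ⟨N, hN.sub_const c⟩

omit [IsAdicComplete (maximalIdeal R) R] in
lemma IsAnalyticAt.comp_add_const {f : (ι → R) → (κ → R)} {y c : ι → R}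
    (hf : IsAnalyticAt f (y + c)) : IsAnalyticAt (fun x => f (x + c)) y := by
  obtain ⟨N, F, hF⟩ := hf
  exact ⟨N, F, fun x hx => by simpa only [add_right_comm y c x] using hF x hx⟩

end Adic

end RAnalytic


namespace RAnalytic

/-! ### Subgroups cut out by polydiscs, and conjugation on them -/

section Standard

variable {R : Type*} [CommRing R] [IsLocalRing R] [TopologicalSpace R]
  [IsAdicComplete (maximalIdeal R) R] {d : ℕ}
  {G : Type*} [Group G] [TopologicalSpace G]

/-- In the coordinates `φ`, which are centred at `1`, the group operations are given by power
series on the polydisc of level `N`. -/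
structure IsLocallyStandard (φ : OpenPartialHomeomorph G (Fin d → R)) (N : ℕ) : Prop where
  level_pos : 1 ≤ N
  one_mem : 1 ∈ φ.source
  map_one : φ 1 = 0
  subset_target : polydisc R (Fin d) N ⊆ φ.target
  mul_mem : ∀ x ∈ polydisc R (Fin d) N, ∀ y ∈ polydisc R (Fin d) N,
    φ.symm x * φ.symm y ∈ φ.source
  mul_expansion : HasExpansionOn (fun z : Fin d ⊕ Fin d → R =>
    φ (φ.symm (z ∘ Sum.inl) * φ.symm (z ∘ Sum.inr))) N
  inv_mem : ∀ x ∈ polydisc R (Fin d) N, (φ.symm x)⁻¹ ∈ φ.source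
  inv_expansion : HasExpansionOn (fun x => φ (φ.symm x)⁻¹) N

namespace IsLocallyStandard

variable {φ : OpenPartialHomeomorph G (Fin d → R)} {M N : ℕ}

omit [IsAdicComplete (maximalIdeal R) R] in
lemma mono (h : IsLocallyStandard φ M) (hMN : M ≤ N) : IsLocallyStandard φ N where
  level_pos := h.level_pos.trans hMN
  one_mem := h.one_mem
  map_one := h.map_one
  subset_target := (polydisc_mono hMN).trans h.subset_target
  mul_mem x hx y hy := h.mul_mem x (polydisc_mono hMN hx) y (polydisc_mono hMN hy)
  mul_expansion := h.mul_expansion.mono hMN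
  inv_mem x hx := h.inv_mem x (polydisc_mono hMN hx)
  inv_expansion := h.inv_expansion.mono hMN

omit [IsAdicComplete (maximalIdeal R) R] in
lemma symm_zero (h : IsLocallyStandard φ N) : φ.symm 0 = 1 := by
  rw [← h.map_one, φ.left_inv h.one_mem]

/-- The series for multiplication vanish at the origin because `1 * 1 = 1`, so they preserve the
polydisc; this gives closure under products. -/
lemma map_mul_mem (h : IsLocallyStandard φ N) (hR : IsAdic (maximalIdeal R)) {x y : Fin d → R}
    (hx : x ∈ polydisc R (Fin d) N) (hy : y ∈ polydisc R (Fin d) N) :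
    φ (φ.symm x * φ.symm y) ∈ polydisc R (Fin d) N := by
  have h0 : φ (φ.symm ((0 : Fin d ⊕ Fin d → R) ∘ Sum.inl) *
      φ.symm ((0 : Fin d ⊕ Fin d → R) ∘ Sum.inr)) = 0 := by
    change φ (φ.symm 0 * φ.symm 0) = 0
    simp [h.symm_zero, h.map_one]
  simpa using h.mul_expansion.mem_polydisc hR le_rfl h0 (elim_mem_polydisc hx hy)

lemma map_inv_mem (h : IsLocallyStandard φ N) (hR : IsAdic (maximalIdeal R)) {x : Fin d → R}
    (hx : x ∈ polydisc R (Fin d) N) : φ (φ.symm x)⁻¹ ∈ polydisc R (Fin d) N :=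
  h.inv_expansion.mem_polydisc hR le_rfl (by simp [h.symm_zero, h.map_one]) hx

/-- The subgroup of all points whose coordinates lie in the polydisc of level `N`. -/
def subgroup (h : IsLocallyStandard φ N) (hR : IsAdic (maximalIdeal R)) : Subgroup G where
  carrier := {g | g ∈ φ.source ∧ φ g ∈ polydisc R (Fin d) N}
  one_mem' := ⟨h.one_mem, h.map_one ▸ zero_mem_polydisc N⟩
  mul_mem' {a b} ha hb := by
    have h1 := h.mul_mem _ ha.2 _ hb.2
    have h2 := h.map_mul_mem hR ha.2 hb.2
    rw [φ.left_inv ha.1, φ.left_inv hb.1] at h1 h2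
    exact ⟨h1, h2⟩
  inv_mem' {a} ha := by
    have h1 := h.inv_mem _ ha.2
    have h2 := h.map_inv_mem hR ha.2
    rw [φ.left_inv ha.1] at h1 h2
    exact ⟨h1, h2⟩

lemma mem_subgroup (h : IsLocallyStandard φ N) (hR : IsAdic (maximalIdeal R)) {g : G} :
    g ∈ h.subgroup hR ↔ g ∈ φ.source ∧ φ g ∈ polydisc R (Fin d) N := Iff.rfl

lemma symm_mem_subgroup (h : IsLocallyStandard φ N) (hR : IsAdic (maximalIdeal R))
    {x : Fin d → R} (hx : x ∈ polydisc R (Fin d) N) : φ.symm x ∈ h.subgroup hR := by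
  rw [mem_subgroup, φ.right_inv (h.subset_target hx)]
  exact ⟨φ.map_target (h.subset_target hx), hx⟩

lemma isOpen_subgroup (h : IsLocallyStandard φ N) (hR : IsAdic (maximalIdeal R)) :
    IsOpen (h.subgroup hR : Set G) :=
  φ.isOpen_inter_preimage (isOpen_polydisc hR N)

lemma mul_expansion_comp (h : IsLocallyStandard φ N) (hR : IsAdic (maximalIdeal R))
    {a b : (Fin d → R) → (Fin d → R)} {L : ℕ} (hL : 1 ≤ L)
    (ha : HasExpansionOn a L) (hb : HasExpansionOn b L)
    (ha' : ∀ x ∈ polydisc R (Fin d) L, a x ∈ polydisc R (Fin d) N)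
    (hb' : ∀ x ∈ polydisc R (Fin d) L, b x ∈ polydisc R (Fin d) N) :
    HasExpansionOn (fun x => φ (φ.symm (a x) * φ.symm (b x))) L := by
  simpa using h.mul_expansion.comp hR h.level_pos hL (ha.sumElim hb)
    fun x hx => elim_mem_polydisc (ha' x hx) (hb' x hx)

/-- Conjugation by `g` preserves the source of `φ` on the polydisc of level `N`, and is given by
power series there. -/
def ConjExpansion (φ : OpenPartialHomeomorph G (Fin d → R)) (N : ℕ) (g : G) : Prop :=
  (∀ x ∈ polydisc R (Fin d) N, g⁻¹ * φ.symm x * g ∈ φ.source) ∧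
    HasExpansionOn (fun x => φ (g⁻¹ * φ.symm x * g)) N

omit [IsAdicComplete (maximalIdeal R) R] in
lemma ConjExpansion.mono {g : G} (h : ConjExpansion φ M g) (hMN : M ≤ N) :
    ConjExpansion φ N g :=
  ⟨fun x hx => h.1 x (polydisc_mono hMN hx), h.2.mono hMN⟩

lemma ConjExpansion.map_mem (h : IsLocallyStandard φ N) (hR : IsAdic (maximalIdeal R)) {g : G}
    (hg : ConjExpansion φ N g) {x : Fin d → R} (hx : x ∈ polydisc R (Fin d) N) :
    φ (g⁻¹ * φ.symm x * g) ∈ polydisc R (Fin d) N :=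
  hg.2.mem_polydisc hR le_rfl (by simp [h.symm_zero, h.map_one]) hx

lemma ConjExpansion.mul (h : IsLocallyStandard φ N) (hR : IsAdic (maximalIdeal R)) {a b : G}
    (ha : ConjExpansion φ N a) (hb : ConjExpansion φ N b) : ConjExpansion φ N (a * b) := by
  have key : ∀ x ∈ polydisc R (Fin d) N,
      b⁻¹ * φ.symm (φ (a⁻¹ * φ.symm x * a)) * b = (a * b)⁻¹ * φ.symm x * (a * b) := fun x hx => by
    rw [φ.left_inv (ha.1 x hx)]
    group
  refine ⟨fun x hx => key x hx ▸ hb.1 _ (ha.map_mem h hR hx), ?_⟩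
  exact (hb.2.comp hR h.level_pos h.level_pos ha.2 fun x hx => ha.map_mem h hR hx).congr
    fun x hx => congrArg φ (key x hx)

/-- Both `g⁻¹` and `g` have constant coordinates inside the polydisc, so two substitutions into the
multiplication series suffice. -/
lemma conjExpansion_of_mem (h : IsLocallyStandard φ N) (hR : IsAdic (maximalIdeal R))
    {g : G} (hg : g ∈ h.subgroup hR) : ConjExpansion φ N g := by
  have hg' := Subgroup.inv_mem _ hg
  have hs : ∀ x ∈ polydisc R (Fin d) N, φ.symm x ∈ h.subgroup hR :=
    fun x hx => h.symm_mem_subgroup hR hx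
  refine ⟨fun x hx => (Subgroup.mul_mem _ (Subgroup.mul_mem _ hg' (hs x hx)) hg).1, ?_⟩
  have h1 := h.mul_expansion_comp hR h.level_pos (hasExpansionOn_const (φ g⁻¹) N)
    (hasExpansionOn_id N) (fun _ _ => hg'.2) (fun _ hx => hx)
  have h1' : ∀ x ∈ polydisc R (Fin d) N,
      φ.symm (φ (φ.symm (φ g⁻¹) * φ.symm x)) = g⁻¹ * φ.symm x := fun x hx => by
    rw [φ.left_inv hg'.1, φ.left_inv (Subgroup.mul_mem _ hg' (hs x hx)).1]
  have h2 := h.mul_expansion_comp hR h.level_pos h1 (hasExpansionOn_const (φ g) N)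
    (fun x hx => h.map_mul_mem hR hg'.2 hx) (fun _ _ => hg.2)
  refine h2.congr fun x hx => ?_
  simp only [h1' x hx, φ.left_inv hg.1]

/-- Here `g` need only lie in the larger subgroup of level `M`. Hence the finite set of cosets stays
fixed while `N` grows. -/
lemma conjExpansion_of_le (h : IsLocallyStandard φ M) (hR : IsAdic (maximalIdeal R))
    (hMN : M ≤ N) {g : G} (hg : g ∈ h.subgroup hR) : ConjExpansion φ N g :=
  (h.conjExpansion_of_mem hR hg).mono hMN

/-- In a compact group there is a level at which conjugation by any element is given by power
series. -/
lemma exists_forall_conjExpansion [CompactSpace G] [IsTopologicalGroup G]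
    (h : IsLocallyStandard φ M) (hR : IsAdic (maximalIdeal R))
    (hconj : ∀ g : G, ∃ N, ConjExpansion φ N g) :
    ∃ N, M ≤ N ∧ ∀ g : G, ConjExpansion φ N g := by
  -- An open subgroup of a compact group has finite index.
  have := Subgroup.quotient_finite_of_isOpen _ (h.isOpen_subgroup hR)
  have := Fintype.ofFinite (G ⧸ h.subgroup hR)
  choose n hn using hconj
  let K := Finset.univ.sup fun q : G ⧸ h.subgroup hR => n q.out
  refine ⟨max M K, le_max_left _ _, fun g => ?_⟩
  have hK : n (g : G ⧸ h.subgroup hR).out ≤ K :=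
    Finset.le_sup (f := fun q : G ⧸ h.subgroup hR => n q.out) (Finset.mem_univ _)
  have hmem : (g : G ⧸ h.subgroup hR).out⁻¹ * g ∈ h.subgroup hR :=
    QuotientGroup.eq.mp (QuotientGroup.out_eq' _)
  -- Write `g` as its coset representative times an element of the level `M` subgroup, and compose
  -- the two conjugations.
  have := ((hn (g : G ⧸ h.subgroup hR).out).mono (hK.trans (le_max_right M K))).mul
    (h.mono (le_max_left M K)) hR (h.conjExpansion_of_le hR (le_max_left M K) hmem)
  rwa [mul_inv_cancel_left] at this

lemma normal_subgroup (h : IsLocallyStandard φ N) (hR : IsAdic (maximalIdeal R))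
    (hconj : ∀ g : G, ConjExpansion φ N g) : (h.subgroup hR).Normal where
  conj_mem s hs g := by
    -- Normality concerns `g * s * g⁻¹`, which is `ConjExpansion` for `g⁻¹`.
    have h1 := (hconj g⁻¹).1 _ hs.2
    have h2 := (hconj g⁻¹).map_mem h hR hs.2
    rw [φ.left_inv hs.1, inv_inv] at h1 h2
    exact ⟨h1, h2⟩

/-- The restriction of `φ` to the subgroup of level `N`. -/
def chart (h : IsLocallyStandard φ N) (hR : IsAdic (maximalIdeal R)) :
    OpenPartialHomeomorph G (Fin d → R) :=
  φ.restrOpen (h.subgroup hR) (h.isOpen_subgroup hR)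

lemma source_chart (h : IsLocallyStandard φ N) (hR : IsAdic (maximalIdeal R)) :
    (h.chart hR).source = h.subgroup hR :=
  Set.inter_eq_right.mpr fun _ hx => hx.1

lemma target_chart (h : IsLocallyStandard φ N) (hR : IsAdic (maximalIdeal R)) :
    (h.chart hR).target = polydisc R (Fin d) N := by
  refine Set.Subset.antisymm (fun x hx => ?_)
    fun x hx => ⟨h.subset_target hx, h.symm_mem_subgroup hR hx⟩
  have h2 : φ (φ.symm x) ∈ polydisc R (Fin d) N := hx.2.2
  rwa [φ.right_inv hx.1] at h2

end IsLocallyStandard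

end Standard

/-! ### From the analytic atlas to expansions in a centred chart -/

section Charts

variable {R : Type*} [CommRing R] [IsLocalRing R] [TopologicalSpace R]
  [IsAdicComplete (maximalIdeal R) R] {d : ℕ}
  {G : Type*} [Group G] [TopologicalSpace G] [ChartedSpace (Fin d → R) G]
  [IsAnalyticGroup R d G]

lemma isAnalyticAt_mul_chart [ContinuousAdd R] (hR : IsAdic (maximalIdeal R))
    {e₁ e₂ e₃ : OpenPartialHomeomorph G (Fin d → R)}
    (h₁ : e₁ ∈ atlas (Fin d → R) G) (h₂ : e₂ ∈ atlas (Fin d → R) G)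
    (h₃ : e₃ ∈ atlas (Fin d → R) G) {a b : (Fin d → R) → (Fin d → R)} {x : Fin d → R}
    (ha : IsAnalyticAt a x) (hb : IsAnalyticAt b x) (ha' : a x ∈ e₁.target)
    (hb' : b x ∈ e₂.target) (hab : e₁.symm (a x) * e₂.symm (b x) ∈ e₃.source) :
    IsAnalyticAt (fun x => e₃ (e₁.symm (a x) * e₂.symm (b x))) x := by
  have hm := IsAnalyticGroup.analytic_mul e₁ h₁ e₂ h₂ e₃ h₃ (Sum.elim (a x) (b x))
    ⟨by simpa using ha', by simpa using hb', by simpa using hab⟩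
  simpa using IsAnalyticAt.comp hR (g := fun x => Sum.elim (a x) (b x)) hm (ha.sumElim hb)

/-- Conjugation is two multiplications: `g⁻¹ * x` is read in a chart at `g⁻¹`, then multiplied by
`g`, read in a chart at `g`, landing back near `1`. -/
lemma isAnalyticAt_conj [ContinuousAdd R] (hR : IsAdic (maximalIdeal R)) (g : G) :
    IsAnalyticAt (fun x => chartAt (Fin d → R) (1 : G)
      (g⁻¹ * (chartAt (Fin d → R) (1 : G)).symm x * g)) (chartAt (Fin d → R) (1 : G) 1) := by
  have : IsTopologicalGroup G := IsAnalyticGroup.toIsTopologicalGroup R d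
  have he := chart_mem_atlas (Fin d → R) (1 : G)
  have hu := chart_mem_atlas (Fin d → R) g⁻¹
  have hv := chart_mem_atlas (Fin d → R) g
  have he1 := mem_chart_source (Fin d → R) (1 : G)
  have hu1 := mem_chart_source (Fin d → R) g⁻¹
  have hv1 := mem_chart_source (Fin d → R) g
  generalize chartAt (Fin d → R) (1 : G) = e at *
  generalize chartAt (Fin d → R) g⁻¹ = u at *
  generalize chartAt (Fin d → R) g = v at *
  have hse := e.left_inv he1
  have hsu := u.left_inv hu1
  have hsv := v.left_inv hv1
  have h1 : IsAnalyticAt (fun x => u (u.symm (u g⁻¹) * e.symm x)) (e 1) :=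
    isAnalyticAt_mul_chart hR hu he hu
      (isAnalyticAt_const (u g⁻¹) (e 1)) (isAnalyticAt_id (e 1)) (u.map_source hu1)
      (e.map_source he1) (by simpa only [hse, hsu, mul_one] using hu1)
  have h2 : IsAnalyticAt
      (fun x => e (u.symm (u (u.symm (u g⁻¹) * e.symm x)) * v.symm (v g))) (e 1) :=
    isAnalyticAt_mul_chart hR hu hv he
      h1 (isAnalyticAt_const (v g) (e 1))
      (by simpa only [hse, hsu, mul_one] using u.map_source hu1) (v.map_source hv1)
      (by simpa only [hse, hsu, hsv, mul_one, inv_mul_cancel] using he1)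
  have hc : ContinuousAt (fun x => g⁻¹ * e.symm x) (e 1) :=
    continuousAt_const.mul (e.continuousAt_symm (e.map_source he1))
  have hmem : ∀ᶠ x in 𝓝 (e 1), g⁻¹ * e.symm x ∈ u.source :=
    hc.eventually_mem (u.open_source.mem_nhds (by simpa only [hse, mul_one] using hu1))
  -- The detour through `u` is the identity only where `g⁻¹ * e.symm x` lies in its source, which
  -- holds near `e 1`.
  refine h2.congr hR ?_
  filter_upwards [hmem] with x hx
  rw [hsu, hsv, u.left_inv hx]

omit [IsAdicComplete (maximalIdeal R) R] in
lemma IsAnalyticAt.exists_hasExpansionOn {ι κ : Type*} {f : (ι → R) → (κ → R)}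
    (hf : IsAnalyticAt f 0) : ∃ N, HasExpansionOn f N := by
  obtain ⟨N, F, hF⟩ := hf
  exact ⟨N, F, by simpa using hF⟩

/-- The chart at `1`, translated so as to be centred at `1`. -/
def centredChart (R : Type*) [CommRing R] [TopologicalSpace R] [IsTopologicalRing R] (d : ℕ)
    (G : Type*) [Group G] [TopologicalSpace G] [ChartedSpace (Fin d → R) G] :
    OpenPartialHomeomorph G (Fin d → R) :=
  (chartAt (Fin d → R) (1 : G)).transHomeomorph
    (Homeomorph.subRight (chartAt (Fin d → R) (1 : G) 1))

section

variable [IsTopologicalRing R]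

omit [IsLocalRing R] [IsAdicComplete (maximalIdeal R) R] [IsAnalyticGroup R d G] in
lemma centredChart_one : centredChart R d G 1 = 0 := sub_self _

omit [IsLocalRing R] [IsAdicComplete (maximalIdeal R) R] [IsAnalyticGroup R d G] in
lemma one_mem_source_centredChart : 1 ∈ (centredChart R d G).source :=
  mem_chart_source (Fin d → R) (1 : G)

omit [IsLocalRing R] [IsAdicComplete (maximalIdeal R) R] [IsAnalyticGroup R d G] in
lemma centredChart_symm_zero : (centredChart R d G).symm 0 = 1 := by
  rw [← centredChart_one (R := R) (d := d) (G := G),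
    (centredChart R d G).left_inv one_mem_source_centredChart]

omit [IsLocalRing R] [IsAdicComplete (maximalIdeal R) R] [IsAnalyticGroup R d G] in
lemma zero_mem_target_centredChart : 0 ∈ (centredChart R d G).target := by
  rw [← centredChart_one (R := R) (d := d) (G := G)]
  exact (centredChart R d G).map_source one_mem_source_centredChart

omit [IsAdicComplete (maximalIdeal R) R] in
lemma compatible_centredChart {e : OpenPartialHomeomorph G (Fin d → R)}
    (he : e ∈ atlas (Fin d → R) G) : Compatible (centredChart R d G) e := by
  have h := IsAnalyticGroup.compatible _ (chart_mem_atlas (Fin d → R) (1 : G)) e he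
  refine ⟨fun x hx => ?_, fun x hx => ?_⟩
  · exact (h.1 (x + chartAt (Fin d → R) (1 : G) 1) hx).comp_add_const
  · exact (h.2 x hx).sub_const _

omit [IsAdicComplete (maximalIdeal R) R] in
lemma exists_isLocallyStandard (hR : IsAdic (maximalIdeal R)) :
    ∃ N, IsLocallyStandard (centredChart R d G) N := by
  have : IsTopologicalGroup G := IsAnalyticGroup.toIsTopologicalGroup R d
  have he := chart_mem_atlas (Fin d → R) (1 : G)
  have he1 := mem_chart_source (Fin d → R) (1 : G)
  have hse := (chartAt (Fin d → R) (1 : G)).left_inv he1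
  set φ := centredChart R d G with hφ
  have hc : ContinuousAt φ.symm 0 := φ.continuousAt_symm zero_mem_target_centredChart
  have h1 : φ.symm 0 = 1 := centredChart_symm_zero
  have hsource : φ.source ∈ 𝓝 1 := φ.open_source.mem_nhds one_mem_source_centredChart
  obtain ⟨N₁, hN₁⟩ := exists_polydisc_subset hR (φ.open_target.mem_nhds
    zero_mem_target_centredChart)
  obtain ⟨N₂, hN₂⟩ : ∃ N, polydisc R (Fin d ⊕ Fin d) N ⊆
      {z | φ.symm (z ∘ Sum.inl) * φ.symm (z ∘ Sum.inr) ∈ φ.source} := by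
    have hl : Tendsto (fun z : Fin d ⊕ Fin d → R => φ.symm (z ∘ Sum.inl)) (𝓝 0) (𝓝 1) := by
      rw [← h1]
      exact hc.tendsto.comp ((continuous_pi fun i => continuous_apply _).tendsto' _ _ rfl)
    have hr : Tendsto (fun z : Fin d ⊕ Fin d → R => φ.symm (z ∘ Sum.inr)) (𝓝 0) (𝓝 1) := by
      rw [← h1]
      exact hc.tendsto.comp ((continuous_pi fun i => continuous_apply _).tendsto' _ _ rfl)
    exact exists_polydisc_subset hR ((hl.mul hr).eventually_mem (by simpa using hsource))
  obtain ⟨N₃, hN₃⟩ : ∃ N, HasExpansionOn (fun z : Fin d ⊕ Fin d → R =>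
      φ (φ.symm (z ∘ Sum.inl) * φ.symm (z ∘ Sum.inr))) N := by
    have hm := IsAnalyticGroup.analytic_mul _ he _ he _ he
      (Sum.elim (chartAt (Fin d → R) (1 : G) 1) (chartAt (Fin d → R) (1 : G) 1))
      ⟨OpenPartialHomeomorph.map_source _ he1, OpenPartialHomeomorph.map_source _ he1, by
        simpa only [Sum.elim_comp_inl, Sum.elim_comp_inr, hse, mul_one] using he1⟩
    -- Viewing the base point as `0 + c` moves the expansion to the origin.
    rw [← zero_add (Sum.elim _ _)] at hm
    exact (hm.comp_add_const.sub_const (chartAt (Fin d → R) (1 : G) 1)).exists_hasExpansionOn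
  obtain ⟨N₄, hN₄⟩ : ∃ N, polydisc R (Fin d) N ⊆ {x | (φ.symm x)⁻¹ ∈ φ.source} :=
    exists_polydisc_subset hR (hc.inv.eventually_mem (by simpa [h1] using hsource))
  obtain ⟨N₅, hN₅⟩ : ∃ N, HasExpansionOn (fun x => φ (φ.symm x)⁻¹) N := by
    have hi := IsAnalyticGroup.analytic_inv _ he _ he (chartAt (Fin d → R) (1 : G) 1)
      ⟨OpenPartialHomeomorph.map_source _ he1, by simpa only [hse, inv_one] using he1⟩
    rw [← zero_add (chartAt (Fin d → R) (1 : G) 1)] at hi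
    exact (hi.comp_add_const.sub_const (chartAt (Fin d → R) (1 : G) 1)).exists_hasExpansionOn
  -- All conditions persist at deeper levels, so the sum serves as a common bound; the `1` makes the
  -- level positive.
  exact ⟨N₁ + N₂ + N₃ + N₄ + N₅ + 1,
    { level_pos := by lia
      one_mem := one_mem_source_centredChart
      map_one := centredChart_one
      subset_target := (polydisc_mono (by lia)).trans hN₁
      mul_mem := fun x hx y hy => by
        simpa using hN₂ (polydisc_mono (by lia) (elim_mem_polydisc hx hy))
      mul_expansion := hN₃.mono (by lia)
      inv_mem := fun x hx => hN₄ (polydisc_mono (by lia) hx)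
      inv_expansion := hN₅.mono (by lia) }⟩

lemma exists_conjExpansion (hR : IsAdic (maximalIdeal R)) (g : G) :
    ∃ N, IsLocallyStandard.ConjExpansion (centredChart R d G) N g := by
  have : IsTopologicalGroup G := IsAnalyticGroup.toIsTopologicalGroup R d
  set φ := centredChart R d G with hφ
  have hc : ContinuousAt (fun x => g⁻¹ * φ.symm x * g) 0 :=
    (continuousAt_const.mul (φ.continuousAt_symm zero_mem_target_centredChart)).mul
      continuousAt_const
  have hsource : φ.source ∈ 𝓝 (g⁻¹ * φ.symm 0 * g) :=
    φ.open_source.mem_nhds (by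
      rw [hφ, centredChart_symm_zero]
      simpa using one_mem_source_centredChart)
  obtain ⟨N₁, hN₁⟩ := exists_polydisc_subset hR (hc.eventually_mem hsource)
  obtain ⟨N₂, hN₂⟩ : ∃ N, HasExpansionOn (fun x => φ (g⁻¹ * φ.symm x * g)) N := by
    have h := isAnalyticAt_conj hR (d := d) g
    rw [← zero_add (chartAt (Fin d → R) (1 : G) 1)] at h
    exact (h.comp_add_const.sub_const (chartAt (Fin d → R) (1 : G) 1)).exists_hasExpansionOn
  exact ⟨max N₁ N₂, fun x hx => hN₁ (polydisc_mono (le_max_left _ _) hx),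
    hN₂.mono (le_max_right _ _)⟩

end

lemma IsLocallyStandard.isStandardSubgroup [IsTopologicalRing R] {N : ℕ}
    (h : IsLocallyStandard (centredChart R d G) N) (hR : IsAdic (maximalIdeal R)) :
    IsStandardSubgroup (h.subgroup hR) N (h.chart hR) where
  level_pos := h.level_pos
  source_eq := h.source_chart hR
  target_eq := h.target_chart hR
  compatible e he :=
    -- Compatibility is a pointwise condition on overlaps, and restricting the chart only shrinks
    -- them.
    have hc := compatible_centredChart he
    ⟨fun x hx => hc.1 x ⟨hx.1.1, hx.2⟩, fun x hx => hc.2 x ⟨hx.1, hx.2.1⟩⟩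
  map_one := h.map_one
  map_mul := by
    have := hR.isHausdorff_iff.mp inferInstance
    obtain ⟨F, hF⟩ := h.mul_expansion
    refine ⟨F, fun j => ?_, fun x hx y hy j => ?_⟩
    · refine constantCoeff_eq_of_hasValueAt ?_
      have h0 := hF 0 (zero_mem_polydisc N) j
      change HasValueAt (F j) 0
        (centredChart R d G ((centredChart R d G).symm 0 * (centredChart R d G).symm 0) j) at h0
      rwa [h.symm_zero, mul_one, h.map_one] at h0
    · have := hF _ (elim_mem_polydisc hx.2 hy.2) j
      beta_reduce at this
      rwa [Sum.elim_comp_inl, Sum.elim_comp_inr, OpenPartialHomeomorph.left_inv _ hx.1,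
        OpenPartialHomeomorph.left_inv _ hy.1] at this

end Charts

end RAnalytic

/-! ### The normal standard subgroup -/

theorem mainTheorem5 (p : ℕ) [Fact p.Prime]
    (R : Type*) [CommRing R] [IsDomain R] [IsLocalRing R] [IsNoetherianRing R]
    [IsAdicComplete (maximalIdeal R) R] [Finite (ResidueField R)] [CharP (ResidueField R) p]
    [TopologicalSpace R] (hR : IsAdic (maximalIdeal R))
    (d : ℕ) (G : Type*) [Group G] [TopologicalSpace G] [CompactSpace G]
    [ChartedSpace (Fin d → R) G] [RAnalytic.IsAnalyticGroup R d G] :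
    ∃ (S : Subgroup G) (N : ℕ) (φ : OpenPartialHomeomorph G (Fin d → R)),
      IsOpen (S : Set G) ∧ S.Normal ∧ RAnalytic.IsStandardSubgroup S N φ ∧
      ∀ g : G, ∃ C : Fin d → MvPowerSeries (Fin d) R,
        ∀ x ∈ S, ∀ j, RAnalytic.HasValueAt (C j) (φ x) (φ (g⁻¹ * x * g) j) := by
  have := RAnalytic.isTopologicalRing_of_isAdic hR
  have : IsTopologicalGroup G := RAnalytic.IsAnalyticGroup.toIsTopologicalGroup R d
  obtain ⟨M, hM⟩ := RAnalytic.exists_isLocallyStandard (d := d) (G := G) hR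
  obtain ⟨N, hMN, hconj⟩ := hM.exists_forall_conjExpansion hR (RAnalytic.exists_conjExpansion hR)
  have hN := hM.mono hMN
  refine ⟨hN.subgroup hR, N, hN.chart hR, hN.isOpen_subgroup hR, hN.normal_subgroup hR hconj,
    hN.isStandardSubgroup hR, fun g => ?_⟩
  obtain ⟨C, hC⟩ := (hconj g).2
  refine ⟨C, fun x hx j => ?_⟩
  have := hC _ hx.2 j
  beta_reduce at this
  rwa [OpenPartialHomeomorph.left_inv _ hx.1] at this
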